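/- Let $A$ be an (additively written) abelian group with torsion subgroup $T(A)$. An endomorphism $\gamma$ of $A$ is called inertial if $(H+H\gamma)/H$ is finite for every subgroup $H\le A$; an inertial automorphism is a bijective inertial endomorphism. Let $\mathrm{IAut}(A)$ be the group generated by all inertial automorphisms of $A$, and let $\mathrm{IAut}_1(A)$ consist of the inertial automorphisms of $A$ that act as the identity map on $A/T(A)$. (1) Let $\pi$ be a set of primes and let $A$ be a non-periodic abelian group (that is, $A\neq T(A)$) which is $\pi$-divisible, i.e. $pA=A$ for every $p\in\pi$. If $T(A)$ is a $\pi$-group (every prime dividing the order of an element of $T(A)$ lies in $\pi$), then $\mathrm{IAut}_1(A)=1$. (2) For every prime $p$, let $\mathbb{Q}_{(p)}$ be the additive group of the rational numbers whose denominator is a power of $p$, and let $\mathbb{Z}(p^\infty)=\mathbb{Q}_{(p)}/\mathbb{Z}$. Then $\mathrm{IAut}(\mathbb{Z}(p^\infty)\oplus\mathbb{Q}_{(p)})=\{\pm1\}$. -/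

import Mathlib

section Inertial

variable {A : Type*} [AddCommGroup A]

/-- An endomorphism `φ` of `A` is inertial if `(H + Hφ) / H` is finite for every subgroup `H`. -/
def IsInertial (φ : AddMonoid.End A) : Prop :=
  ∀ H : AddSubgroup A,
    Finite (↥(H ⊔ H.map (φ : A →+ A)) ⧸ H.addSubgroupOf (H ⊔ H.map (φ : A →+ A)))

variable (A)

/-- `IAut(A)`: the group generated by all inertial automorphisms of `A`. The automorphism group
of `A` is the unit group of its endomorphism ring. -/
def IAut : Subgroup (AddMonoid.End A)ˣ :=
  Subgroup.closure {γ | IsInertial (γ : AddMonoid.End A)}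

/-- `IAut₁(A)`: the inertial automorphisms of `A` that act as the identity map on `A / T(A)`,
where `T(A)` is the torsion subgroup of `A`. -/
def IAut₁ : Set (AddMonoid.End A)ˣ :=
  {γ | IsInertial (γ : AddMonoid.End A) ∧
    ∀ a : A, (QuotientAddGroup.mk ((γ : AddMonoid.End A) a) : A ⧸ AddCommGroup.torsion A) =
      QuotientAddGroup.mk a}

/-- `A` is `π`-divisible if `pA = A` for every `p ∈ π`. -/
def IsPiDivisible (π : Set ℕ) : Prop :=
  ∀ p ∈ π, ∀ a : A, ∃ b : A, p • b = a

/-- `A` is a `π`-group if every element of `A` has finite order and all the prime divisors of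
this order lie in `π`. -/
def IsPiGroup (π : Set ℕ) : Prop :=
  ∀ a : A, IsOfFinAddOrder a ∧ ∀ q : ℕ, q.Prime → q ∣ addOrderOf a → q ∈ π

end Inertial

/-- The additive group of the rational numbers whose denominator is a power of the prime `p`. -/
def RatPow (p : ℕ) [hp : Fact p.Prime] : AddSubgroup ℚ where
  carrier := {q | ∃ k : ℕ, q.den = p ^ k}
  zero_mem' := ⟨0, by simp⟩
  add_mem' := by
    rintro a b ⟨k, hk⟩ ⟨l, hl⟩
    have h := Rat.add_den_dvd a b
    rw [hk, hl, ← pow_add] at h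
    obtain ⟨m, -, hm⟩ := (Nat.dvd_prime_pow hp.out).1 h
    exact ⟨m, hm⟩
  neg_mem' := by
    rintro a ⟨k, hk⟩
    exact ⟨k, by simpa using hk⟩

/-- The quasicyclic (Prüfer) group `ℤ(p^∞)`: the quotient by `ℤ` of the additive group of the
rational numbers whose denominator is a power of `p`. -/
def Quasicyclic (p : ℕ) [Fact p.Prime] : Type :=
  ↥(RatPow p) ⧸ (Int.castAddHom ℚ).range.addSubgroupOf (RatPow p)

noncomputable instance (p : ℕ) [Fact p.Prime] : AddCommGroup (Quasicyclic p) :=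
  inferInstanceAs
    (AddCommGroup (↥(RatPow p) ⧸ (Int.castAddHom ℚ).range.addSubgroupOf (RatPow p)))

/-! ### Inertial endomorphisms with torsion values; the triviality of `IAut₁`. -/

section Inertial

variable {A : Type*} [AddCommGroup A]

/-! Both parts rest on `IsInertial.eq_zero_of_isOfFinAddOrder`: under the divisibility hypotheses,
an inertial `δ` with torsion values vanishes. If `a` has infinite order and a prime `p` divides the
order of `δ a`, then `a` lies in a `p`-divisible torsion-free subgroup `H`. Since `δ(H)` meets `H`
trivially, inertiality makes `δ(H)` finite; being `p`-divisible, it has no `p`-torsion, a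
contradiction. Part (1) takes `δ = γ - 1`. In part (2), `γ` induces multiplication by some rational
`r` modulo torsion, and `δ = r.den • γ - r.num` vanishes; bijectivity then leaves `r = ±1`. -/

theorem isInertial_iff_relIndex {φ : AddMonoid.End A} :
    IsInertial φ ↔ ∀ H : AddSubgroup A, H.relIndex (H.map (φ : A →+ A)) ≠ 0 := by
  refine forall_congr' fun H => ?_
  rw [← AddSubgroup.relIndex_sup_left, sup_comm, AddSubgroup.relIndex,
    AddSubgroup.index_ne_zero_iff_finite]

theorem AddMonoid.End.zsmul_add_intCast_apply (φ : AddMonoid.End A) (m n : ℤ) (a : A) :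
    (m • φ + (n : AddMonoid.End A)) a = m • φ a + n • a :=
  congrArg (m • φ a + ·) (AddMonoid.End.intCast_apply n a)

/-- Integral affine combinations `m φ + n` of an inertial endomorphism are inertial. -/
theorem IsInertial.zsmul_add_intCast {φ : AddMonoid.End A} (h : IsInertial φ) (m n : ℤ) :
    IsInertial (m • φ + (n : AddMonoid.End A)) := by
  rw [isInertial_iff_relIndex] at h ⊢
  intro H
  have h1 : H.relIndex (H.map (φ : A →+ A) ⊔ H) ≠ 0 := by
    rw [AddSubgroup.relIndex_sup_right]
    exact h H
  refine fun h0 => h1 (AddSubgroup.relIndex_eq_zero_of_le_right ?_ h0)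
  rintro _ ⟨x, hx, rfl⟩
  exact (φ.zsmul_add_intCast_apply m n x).symm ▸
    AddSubgroup.add_mem_sup (zsmul_mem (AddSubgroup.mem_map_of_mem (φ : A →+ A) hx) m)
      (zsmul_mem hx n)

theorem isInertial_intCast (n : ℤ) : IsInertial (n : AddMonoid.End A) := by
  have h : IsInertial (1 : AddMonoid.End A) := by
    rw [isInertial_iff_relIndex]
    intro H
    have : H.map ((1 : AddMonoid.End A) : A →+ A) = H := AddSubgroup.map_id H
    rw [this, AddSubgroup.relIndex_self]
    exact one_ne_zero
  simpa using h.zsmul_add_intCast 0 n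

/-- An element of infinite order in a `p`-divisible group lies in a `p`-divisible subgroup
without nonzero elements of finite order. -/
theorem exists_torsionFree_divisible_addSubgroup {p : ℕ} (hp : ∀ a : A, ∃ b : A, p • b = a)
    {a : A} (ha : ¬ IsOfFinAddOrder a) :
    ∃ H : AddSubgroup A, a ∈ H ∧ (∀ x ∈ H, IsOfFinAddOrder x → x = 0) ∧
      ∀ x ∈ H, ∃ y ∈ H, p • y = x := by
  -- `H` is the union of the cyclic groups generated by successive `p`-th parts of `a`.
  choose f hf using hp
  set c : ℕ → A := fun n => f^[n] a with hc
  have hcs : ∀ n, p • c (n + 1) = c n := fun n => by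
    simp only [hc, Function.iterate_succ_apply', hf]
  have hinf : ∀ n, ¬ IsOfFinAddOrder (c n) := by
    intro n
    induction n with
    | zero => exact ha
    | succ n ih => exact fun h => ih (hcs n ▸ h.nsmul)
  have hmono : Monotone fun n => AddSubgroup.zmultiples (c n) := by
    refine monotone_nat_of_le_succ fun n => ?_
    rw [AddSubgroup.zmultiples_le, ← hcs n]
    exact nsmul_mem (AddSubgroup.mem_zmultiples _) p
  have hmem : ∀ x, x ∈ (⨆ n, AddSubgroup.zmultiples (c n)) ↔ ∃ n, ∃ k : ℤ, k • c n = x := by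
    intro x
    rw [AddSubgroup.mem_iSup_of_directed hmono.directed_le]
    simp only [AddSubgroup.mem_zmultiples_iff]
  refine ⟨⨆ n, AddSubgroup.zmultiples (c n), (hmem a).2 ⟨0, 1, one_zsmul _⟩, ?_, ?_⟩
  · intro x hx hfin
    obtain ⟨n, k, rfl⟩ := (hmem x).1 hx
    by_contra hne
    have hk : k ≠ 0 := by
      rintro rfl
      exact hne (zero_zsmul _)
    obtain ⟨l, hl, hl0⟩ := isOfFinAddOrder_iff_zsmul_eq_zero.1 hfin
    exact hinf n (isOfFinAddOrder_iff_zsmul_eq_zero.2 ⟨l * k, mul_ne_zero hl hk, by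
      rw [mul_zsmul, hl0]⟩)
  · intro x hx
    obtain ⟨n, k, rfl⟩ := (hmem x).1 hx
    exact ⟨k • c (n + 1), (hmem _).2 ⟨n + 1, k, rfl⟩, by rw [smul_comm, hcs]⟩

/-- An inertial endomorphism with values in the torsion subgroup has finite image on every
subgroup without torsion. -/
theorem IsInertial.finite_map {δ : AddMonoid.End A} (h : IsInertial δ)
    (hδ : ∀ a, IsOfFinAddOrder (δ a)) {H : AddSubgroup A}
    (hH : ∀ x ∈ H, IsOfFinAddOrder x → x = 0) : Finite (H.map (δ : A →+ A)) := by
  have h1 := isInertial_iff_relIndex.1 h H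
  have h2 : H ⊓ H.map (δ : A →+ A) = ⊥ := by
    rw [eq_bot_iff]
    rintro x ⟨hx, y, -, rfl⟩
    exact hH _ hx (hδ y)
  -- With trivial intersection, the relative index is the cardinality of the image.
  rw [← AddSubgroup.inf_relIndex_right, h2, AddSubgroup.relIndex_bot_left] at h1
  exact Nat.finite_of_card_ne_zero h1

theorem IsInertial.eq_zero_of_isOfFinAddOrder {δ : AddMonoid.End A} (h : IsInertial δ)
    (hδ : ∀ a, IsOfFinAddOrder (δ a)) {π : Set ℕ} (hdiv : IsPiDivisible A π)
    (hA : ∃ a : A, ¬ IsOfFinAddOrder a)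
    (hT : ∀ a : A, IsOfFinAddOrder a → ∀ q : ℕ, q.Prime → q ∣ addOrderOf a → q ∈ π) :
    δ = 0 := by
  have key : ∀ a : A, ¬ IsOfFinAddOrder a → δ a = 0 := by
    intro a ha
    by_contra hne
    obtain ⟨p, hp, hpd⟩ := Nat.exists_prime_and_dvd (mt AddMonoid.addOrderOf_eq_one_iff.1 hne)
    obtain ⟨H, haH, hH, hHd⟩ :=
      exists_torsionFree_divisible_addSubgroup (hdiv p (hT _ (hδ a) p hp hpd)) ha
    have := h.finite_map hδ hH
    have hsurj : Function.Surjective fun x : H.map (δ : A →+ A) => p • x := by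
      rintro ⟨_, x, hx, rfl⟩
      obtain ⟨y, hy, rfl⟩ := hHd x hx
      exact ⟨⟨_, y, hy, rfl⟩, Subtype.ext (map_nsmul (δ : A →+ A) p y).symm⟩
    have hinj := Finite.injective_iff_surjective.2 hsurj
    obtain ⟨m, hm⟩ := hpd
    have hpos : 0 < addOrderOf (δ a) := (hδ a).addOrderOf_pos
    -- The order of `δ a` is `p * m`, so injectivity of multiplication by `p` gives the smaller
    -- annihilator `m`.
    have h0 : m • (⟨δ a, a, haH, rfl⟩ : H.map (δ : A →+ A)) = 0 := by
      refine hinj (Subtype.ext ?_)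
      change p • m • δ a = p • 0
      rw [← mul_nsmul', ← hm, addOrderOf_nsmul_eq_zero, nsmul_zero]
    have hmz : m • δ a = 0 := congrArg Subtype.val h0
    have hm0 : 0 < m := Nat.pos_of_ne_zero (by rintro rfl; omega)
    have hle := Nat.le_of_dvd hm0 (addOrderOf_dvd_of_nsmul_eq_zero hmz)
    have := hp.two_le
    nlinarith
  obtain ⟨a, ha⟩ := hA
  ext t
  by_cases ht : IsOfFinAddOrder t
  -- A torsion `t` is the difference of `a + t` and `a`, both of infinite order.
  · have h1 : ¬ IsOfFinAddOrder (a + t) := fun h => ha (by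
      simpa using h.add (ht.neg))
    have h2 := key _ h1
    rw [map_add, key a ha, zero_add] at h2
    exact h2
  · exact key t ht

theorem IAut₁_eq_singleton {π : Set ℕ} (hdiv : IsPiDivisible A π) (hA : ¬ IsAddTorsion A)
    (hT : IsPiGroup (AddCommGroup.torsion A) π) : IAut₁ A = {1} := by
  refine Set.eq_singleton_iff_unique_mem.2 ⟨⟨?_, fun a => rfl⟩, ?_⟩
  · simpa using isInertial_intCast (A := A) 1
  · rintro γ ⟨hγ, hγ1⟩
    have h0 := (hγ.zsmul_add_intCast 1 (-1)).eq_zero_of_isOfFinAddOrder (π := π) (fun a => by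
        have h1 := QuotientAddGroup.eq.1 (hγ1 a).symm
        have h2 : IsOfFinAddOrder (-a + (γ : AddMonoid.End A) a) := h1
        rw [AddMonoid.End.zsmul_add_intCast_apply, one_zsmul, neg_one_zsmul, add_comm]
        exact h2) hdiv (by
        by_contra! h
        exact hA h) (fun a ha q hq hqd => (hT ⟨a, ha⟩).2 q hq (by
          rwa [← AddSubgroup.addOrderOf_coe]))
    refine Units.ext ?_
    have h3 : (γ : AddMonoid.End A) + -1 = 0 := by simpa using h0
    exact add_neg_eq_zero.1 h3

end Inertial

/-! ### The group `ℤ(p^∞) ⊕ ℚ_(p)`. -/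

section RatPow

variable (p : ℕ) [hp : Fact p.Prime]

theorem intCast_mem_RatPow (n : ℤ) : (n : ℚ) ∈ RatPow p := ⟨0, by simp⟩

theorem div_pow_mem_RatPow (n : ℤ) (k : ℕ) : (n : ℚ) / (p : ℚ) ^ k ∈ RatPow p := by
  have h : (((n : ℚ) / (p : ℚ) ^ k).den : ℤ) ∣ (p : ℤ) ^ k := by
    have := Rat.den_dvd n ((p : ℤ) ^ k)
    rw [Rat.divInt_eq_div] at this
    exact_mod_cast this
  obtain ⟨m, -, hm⟩ := (Nat.dvd_prime_pow hp.out).1 (Int.natCast_dvd_natCast.1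
    (h.trans (Nat.cast_pow p k).symm.dvd))
  exact ⟨m, hm⟩

variable {p}

theorem RatPow.exists_pow_nsmul (q : RatPow p) : ∃ (k : ℕ) (n : ℤ), p ^ k • (q : ℚ) = n := by
  obtain ⟨q, k, hk⟩ := q
  refine ⟨k, q.num, ?_⟩
  rw [nsmul_eq_mul, ← hk, mul_comm, Rat.mul_den_eq_num]

theorem RatPow.exists_nsmul (q : RatPow p) : ∃ r : RatPow p, p • r = q := by
  have hp0 : (p : ℚ) ≠ 0 := by exact_mod_cast hp.out.ne_zero
  obtain ⟨k, n, h⟩ := RatPow.exists_pow_nsmul q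
  refine ⟨⟨_, div_pow_mem_RatPow p n (k + 1)⟩, Subtype.ext ?_⟩
  change p • ((n : ℚ) / (p : ℚ) ^ (k + 1)) = q
  rw [← h, nsmul_eq_mul, nsmul_eq_mul]
  push_cast
  field_simp
  ring

theorem RatPow.isOfFinAddOrder_iff {q : RatPow p} : IsOfFinAddOrder q ↔ q = 0 := by
  refine ⟨fun h => ?_, fun h => h ▸ IsOfFinAddOrder.zero⟩
  obtain ⟨n, hn, h⟩ := isOfFinAddOrder_iff_nsmul_eq_zero.1 h
  exact (smul_eq_zero.1 h).resolve_left hn.ne'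

/-- Homomorphisms `ℚ_(p) → ℚ_(p)` are multiplications by a rational number. -/
theorem RatPow.coe_map_eq (f : RatPow p →+ RatPow p) (q : RatPow p) :
    (f q : ℚ) = f ⟨((1 : ℤ) : ℚ), intCast_mem_RatPow p 1⟩ * q := by
  have hp0 : (p : ℚ) ≠ 0 := by exact_mod_cast hp.out.ne_zero
  obtain ⟨k, n, h⟩ := RatPow.exists_pow_nsmul q
  have h1 : p ^ k • q = n • (⟨((1 : ℤ) : ℚ), intCast_mem_RatPow p 1⟩ : RatPow p) :=
    Subtype.ext (by simpa using h)
  have h2 := congrArg (fun x => (f x : ℚ)) h1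
  simp only [map_nsmul, map_zsmul, AddSubgroup.coe_nsmul, AddSubgroup.coe_zsmul,
    nsmul_eq_mul, zsmul_eq_mul, Nat.cast_pow, ← h] at h2
  have hpk : (p : ℚ) ^ k ≠ 0 := pow_ne_zero _ hp0
  apply mul_left_cancel₀ hpk
  rw [h2]
  ring

theorem Quasicyclic.exists_pow_nsmul_eq_zero (x : Quasicyclic p) : ∃ k : ℕ, p ^ k • x = 0 := by
  obtain ⟨q, rfl⟩ := QuotientAddGroup.mk_surjective x
  obtain ⟨k, n, h⟩ := RatPow.exists_pow_nsmul q
  exact ⟨k, (QuotientAddGroup.eq_zero_iff (p ^ k • q)).2 ⟨n, h.symm⟩⟩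

theorem Quasicyclic.exists_nsmul (x : Quasicyclic p) : ∃ y : Quasicyclic p, p • y = x := by
  obtain ⟨q, rfl⟩ := QuotientAddGroup.mk_surjective x
  obtain ⟨r, rfl⟩ := RatPow.exists_nsmul q
  exact ⟨QuotientAddGroup.mk r, rfl⟩

variable (p) in
theorem Quasicyclic.exists_ne_zero : ∃ x : Quasicyclic p, x ≠ 0 ∧ p • x = 0 := by
  have hp0 : (p : ℚ) ≠ 0 := by exact_mod_cast hp.out.ne_zero
  refine ⟨QuotientAddGroup.mk ⟨_, div_pow_mem_RatPow p 1 1⟩, fun h => ?_, ?_⟩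
  · obtain ⟨n, hn⟩ := (QuotientAddGroup.eq_zero_iff _).1 h
    have h1 : (n : ℚ) = ((1 : ℤ) : ℚ) / (p : ℚ) ^ 1 := hn
    have h2 : (n * p : ℤ) = 1 := by
      have : (n : ℚ) * p = 1 := by rw [h1]; field_simp; norm_num
      exact_mod_cast this
    have h3 : (p : ℤ) ∣ 1 := ⟨n, by rw [← h2, mul_comm]⟩
    exact hp.out.one_lt.ne' (by exact_mod_cast Int.eq_one_of_dvd_one (by positivity) h3)
  · refine (QuotientAddGroup.eq_zero_iff (p • (⟨_, div_pow_mem_RatPow p 1 1⟩ : RatPow p))).2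
      ⟨1, ?_⟩
    change ((1 : ℤ) : ℚ) = p • (((1 : ℤ) : ℚ) / (p : ℚ) ^ 1)
    rw [nsmul_eq_mul]
    field_simp

variable (p)

theorem isPiDivisible_quasicyclic_prod : IsPiDivisible (Quasicyclic p × RatPow p) {p} := by
  rintro _ rfl ⟨x, q⟩
  obtain ⟨y, hy⟩ := x.exists_nsmul
  obtain ⟨r, hr⟩ := RatPow.exists_nsmul q
  exact ⟨(y, r), Prod.ext hy hr⟩

variable {p}

theorem quasicyclic_prod_exists_pow_nsmul_eq_zero {a : Quasicyclic p × RatPow p}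
    (ha : a.2 = 0) : ∃ k : ℕ, p ^ k • a = 0 := by
  obtain ⟨k, hk⟩ := a.1.exists_pow_nsmul_eq_zero
  exact ⟨k, Prod.ext hk (by simp [ha])⟩

theorem quasicyclic_prod_isOfFinAddOrder_iff {a : Quasicyclic p × RatPow p} :
    IsOfFinAddOrder a ↔ a.2 = 0 := by
  refine ⟨fun h => RatPow.isOfFinAddOrder_iff.1
    ((AddMonoidHom.snd (Quasicyclic p) (RatPow p)).isOfFinAddOrder h), fun h => ?_⟩
  obtain ⟨k, hk⟩ := quasicyclic_prod_exists_pow_nsmul_eq_zero h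
  exact isOfFinAddOrder_iff_nsmul_eq_zero.2 ⟨p ^ k, pow_pos hp.out.pos k, hk⟩

/-- An inertial endomorphism of `ℤ(p^∞) ⊕ ℚ_(p)` is multiplication by a rational number. -/
theorem IsInertial.exists_smul_eq {γ : AddMonoid.End (Quasicyclic p × RatPow p)}
    (h : IsInertial γ) : ∃ r ∈ RatPow p, ∀ a, (r.den : ℤ) • γ a = r.num • a := by
  set f : RatPow p →+ RatPow p := (AddMonoidHom.snd (Quasicyclic p) (RatPow p)).comp
    ((γ : Quasicyclic p × RatPow p →+ Quasicyclic p × RatPow p).comp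
      (AddMonoidHom.inr (Quasicyclic p) (RatPow p))) with hf
  set r : RatPow p := f ⟨((1 : ℤ) : ℚ), intCast_mem_RatPow p 1⟩ with hr
  have hγ : ∀ a, ((γ a).2 : ℚ) = r * a.2 := by
    rintro ⟨x, q⟩
    -- `γ (x, 0)` is torsion, so only `q` affects the second coordinate.
    have h1 : γ (x, q) = γ (x, 0) + γ (0, q) := by rw [← map_add]; simp
    have h2 : IsOfFinAddOrder (γ (x, 0)) :=
      (γ : Quasicyclic p × RatPow p →+ Quasicyclic p × RatPow p).isOfFinAddOrder
        (quasicyclic_prod_isOfFinAddOrder_iff.2 rfl)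
    rw [h1, Prod.snd_add, quasicyclic_prod_isOfFinAddOrder_iff.1 h2, zero_add]
    exact RatPow.coe_map_eq f q
  have happ := fun a => (γ.zsmul_add_intCast_apply (r : ℚ).den (-(r : ℚ).num) a).trans
    (by rw [neg_zsmul, ← sub_eq_add_neg])
  have h0 := (h.zsmul_add_intCast (r : ℚ).den (-(r : ℚ).num)).eq_zero_of_isOfFinAddOrder
    (fun a => by
      rw [quasicyclic_prod_isOfFinAddOrder_iff, happ]
      refine Subtype.ext ?_
      change ((r : ℚ).den : ℤ) • ((γ a).2 : ℚ) - (r : ℚ).num • (a.2 : ℚ) = 0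
      rw [hγ, zsmul_eq_mul, zsmul_eq_mul, ← mul_assoc, ← sub_mul]
      push_cast
      rw [Rat.den_mul_eq_num, sub_self, zero_mul])
    (isPiDivisible_quasicyclic_prod p)
    ⟨(0, ⟨((1 : ℤ) : ℚ), intCast_mem_RatPow p 1⟩), fun h1 => by
      have h2 := congrArg Subtype.val (quasicyclic_prod_isOfFinAddOrder_iff.1 h1)
      norm_num at h2⟩
    (fun a ha q hq hqd => by
      obtain ⟨k, hk⟩ := quasicyclic_prod_exists_pow_nsmul_eq_zero
        (quasicyclic_prod_isOfFinAddOrder_iff.1 ha)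
      exact (Nat.prime_dvd_prime_iff_eq hq hp.out).1
        (hq.dvd_of_dvd_pow (hqd.trans (addOrderOf_dvd_of_nsmul_eq_zero hk))))
  refine ⟨r, r.2, fun a => ?_⟩
  rw [← sub_eq_zero, ← happ, h0]
  rfl

theorem IsInertial.eq_one_or_eq_neg_one {γ : (AddMonoid.End (Quasicyclic p × RatPow p))ˣ}
    (h : IsInertial (γ : AddMonoid.End (Quasicyclic p × RatPow p))) : γ = 1 ∨ γ = -1 := by
  obtain ⟨r, ⟨k, hk⟩, hr⟩ := h.exists_smul_eq
  obtain ⟨x, hx0, hx⟩ := Quasicyclic.exists_ne_zero p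
  have hright : ∀ a, (γ : AddMonoid.End (Quasicyclic p × RatPow p))
      ((γ⁻¹).val a) = a := fun a =>
    congrArg (fun φ : AddMonoid.End (Quasicyclic p × RatPow p) => φ a) γ.mul_inv
  have hleft : ∀ a, (γ⁻¹).val
      ((γ : AddMonoid.End (Quasicyclic p × RatPow p)) a) = a := fun a =>
    congrArg (fun φ : AddMonoid.End (Quasicyclic p × RatPow p) => φ a) γ.inv_mul
  have hxp : ∀ n : ℤ, (p : ℤ) ∣ n → n • (x, (0 : RatPow p)) = 0 := by
    rintro _ ⟨c, rfl⟩
    rw [mul_comm, mul_zsmul, natCast_zsmul,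
      show p • (x, (0 : RatPow p)) = 0 from Prod.ext hx (smul_zero p), smul_zero]
  have hxp' : ∀ n : ℤ, n • (x, (0 : RatPow p)) = 0 → (p : ℤ) ∣ n := by
    intro n hn
    have h1 : addOrderOf x = p := addOrderOf_eq_prime hx hx0
    rw [← h1]
    exact addOrderOf_dvd_iff_zsmul_eq_zero.2 (congrArg Prod.fst hn)
  have hden : r.den = 1 := by
    rcases Nat.eq_zero_or_pos k with rfl | hkpos
    · simpa using hk
    have hpd : p ∣ r.den := hk ▸ dvd_pow_self p hkpos.ne'
    have h1 := hr (x, 0)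
    -- If `p` divides `r.den`, then `r.num` kills `x`, which has order `p`; so `p` divides `r.num`
    -- too, and `r` is not reduced.
    rw [← map_zsmul, hxp _ (by exact_mod_cast hpd), map_zero] at h1
    have h2 : p ∣ r.num.natAbs := Int.natCast_dvd.1 (hxp' _ h1.symm)
    exact absurd (Nat.dvd_gcd h2 hpd) (by
      rw [r.reduced.gcd_eq_one]
      exact hp.out.one_lt.ne' ∘ Nat.dvd_one.1)
  have hγ : ∀ a, (γ : AddMonoid.End (Quasicyclic p × RatPow p)) a = r.num • a := fun a => by
    have := hr a
    rwa [hden, Nat.cast_one, one_zsmul] at this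
  have hpn : ¬ (p : ℤ) ∣ r.num := fun hd => by
    have h1 := hleft (x, 0)
    rw [hγ, hxp _ hd, map_zero] at h1
    exact hx0 (congrArg Prod.fst h1).symm
  -- Surjectivity onto `ℚ_(p)` makes `r.num` divide a power of `p`, while it is coprime to `p`.
  have hunit : IsUnit r.num := by
    have h1 := congrArg Prod.snd (hright (0, ⟨((1 : ℤ) : ℚ), intCast_mem_RatPow p 1⟩))
    rw [hγ, Prod.smul_snd] at h1
    generalize ((γ⁻¹).val _).2 = b at h1
    obtain ⟨l, n, hl⟩ := RatPow.exists_pow_nsmul b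
    have h2 : r.num * n = (p : ℤ) ^ l := by
      have h3 : r.num • (b : ℚ) = ((1 : ℤ) : ℚ) := congrArg Subtype.val h1
      have h4 : (r.num : ℚ) * n = (p : ℚ) ^ l := by
        rw [← hl, nsmul_eq_mul, mul_left_comm, ← zsmul_eq_mul, h3]
        push_cast
        ring
      exact_mod_cast h4
    have hcop : IsCoprime ((p : ℤ) ^ l) r.num :=
      ((Nat.prime_iff_prime_int.1 hp.out).coprime_iff_not_dvd.2 hpn).pow_left
    exact hcop.symm.isUnit_of_dvd' dvd_rfl ⟨n, h2.symm⟩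
  rcases Int.isUnit_iff.1 hunit with h1 | h1
  · refine Or.inl (Units.ext (AddMonoidHom.ext fun a => ?_))
    exact (hγ a).trans (by rw [h1, one_zsmul]; rfl)
  · refine Or.inr (Units.ext (AddMonoidHom.ext fun a => ?_))
    exact (hγ a).trans (by rw [h1, neg_one_zsmul]; rfl)

variable (p)

theorem IAut_quasicyclic_prod :
    (IAut (Quasicyclic p × RatPow p) : Set (AddMonoid.End (Quasicyclic p × RatPow p))ˣ) =
      {1, -1} := by
  refine Set.Subset.antisymm (fun γ hγ => ?_) ?_
  · refine Subgroup.closure_induction (p := fun γ _ => γ ∈ ({1, -1} : Set _))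
      (fun γ h => IsInertial.eq_one_or_eq_neg_one h) (Or.inl rfl) ?_ ?_ hγ
    · rintro a b - - (rfl | rfl) (rfl | rfl)
      exacts [Or.inl (one_mul _), Or.inr (one_mul _), Or.inr (mul_one _),
        Or.inl (Units.ext ((neg_mul_neg _ _).trans (mul_one _)))]
    · rintro a - (rfl | rfl)
      exacts [Or.inl inv_one, Or.inr (inv_eq_of_mul_eq_one_right (Units.ext ((neg_mul_neg _ _).trans (mul_one _))))]
  · rintro _ (rfl | rfl)
    · exact one_mem _
    · refine Subgroup.subset_closure ?_
      change IsInertial ((-1 : (AddMonoid.End (Quasicyclic p × RatPow p))ˣ) :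
        AddMonoid.End (Quasicyclic p × RatPow p))
      simpa using isInertial_intCast (A := Quasicyclic p × RatPow p) (-1)

end RatPow

theorem mainTheorem10 :
    (∀ (A : Type*) [AddCommGroup A] (π : Set ℕ), (∀ p ∈ π, p.Prime) →
      IsPiDivisible A π → ¬ IsAddTorsion A → IsPiGroup (AddCommGroup.torsion A) π →
        IAut₁ A = {1}) ∧
    (∀ (p : ℕ) [Fact p.Prime],
      (IAut (Quasicyclic p × RatPow p) : Set (AddMonoid.End (Quasicyclic p × RatPow p))ˣ) =
        {1, -1}) :=
  ⟨fun _ _ _ _ hdiv hA hT => IAut₁_eq_singleton hdiv hA hT, fun p _ => IAut_quasicyclic_prod p⟩
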